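/- Let $n$ be a natural number, $1\le p<\infty$, and let $K\subset\mathbb R^n$ be a convex body (compact and convex, not necessarily symmetric) with the origin in its interior, with Minkowski functional $\|x\|_K=\min\{\lambda\ge 0: x\in\lambda K\}$. Write $(t)_+=\max\{0,t\}$, and let $$Z_p^{+,*}K=\Big\{v\in\mathbb R^n: \Big((n+p)\int_K (v\cdot x)_+^p\,dx\Big)^{1/p}\le 1\Big\}$$ be the polar asymmetric $L_p$ moment body of $K$. Its Minkowski functional satisfies $$\|v\|_{Z_p^{+,*}K}^p=(n+p)\int_K (v\cdot x)_+^p\,dx\qquad\text{for all } v\in\mathbb R^n .$$ If $f\in W^{1,p}(\mathbb R^n)$ has compact (essential) support and $\nabla f$ denotes its weak gradient, then $\int_{\mathbb R^n}\|\nabla f(x)\|_{Z_p^{+,*}K}^p\,dx<\infty$ and $$\lim_{s\to1^-}(1-s)\int_{\mathbb R^n}\int_{\mathbb R^n}\frac{(f(x)-f(y))_+^p}{\|x-y\|_K^{n+sp}}\,dx\,dy=\frac1p\int_{\mathbb R^n}\|\nabla f(x)\|_{Z_p^{+,*}K}^p\,dx .$$ -/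

import Mathlib

open MeasureTheory Filter Topology
open scoped ENNReal ContDiff

noncomputable section

/-- `g` is a weak gradient of `f` on `ℝⁿ`: both functions are locally integrable and
`∫ f ∂ᵢφ = - ∫ gᵢ φ` for every smooth compactly supported `φ` and every coordinate `i`. -/
structure HasWeakGradient {n : ℕ} (f : EuclideanSpace ℝ (Fin n) → ℝ)
    (g : EuclideanSpace ℝ (Fin n) → EuclideanSpace ℝ (Fin n)) : Prop where
  locallyIntegrable : LocallyIntegrable f volume
  locallyIntegrable_grad : LocallyIntegrable g volume
  integral_eq : ∀ φ : EuclideanSpace ℝ (Fin n) → ℝ, ContDiff ℝ ∞ φ → HasCompactSupport φ →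
    ∀ i : Fin n,
      ∫ x, f x * fderiv ℝ φ x (EuclideanSpace.single i 1) = - ∫ x, g x i * φ x

/-- The Sobolev space `W^{1,p}(ℝⁿ)`: `f ∈ L^p` has a weak gradient in `L^p`. -/
def MemW1p {n : ℕ} (p : ℝ) (f : EuclideanSpace ℝ (Fin n) → ℝ) : Prop :=
  MemLp f (ENNReal.ofReal p) volume ∧
    ∃ g : EuclideanSpace ℝ (Fin n) → EuclideanSpace ℝ (Fin n),
      HasWeakGradient f g ∧ MemLp g (ENNReal.ofReal p) volume

/-- `f` vanishes almost everywhere outside a compact set, i.e. the (essential) support of `f`,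
as an element of `L^p`, is compact. -/
def HasCompactEssSupport {n : ℕ} (f : EuclideanSpace ℝ (Fin n) → ℝ) : Prop :=
  ∃ C : Set (EuclideanSpace ℝ (Fin n)), IsCompact C ∧ ∀ᵐ x ∂volume, x ∉ C → f x = 0

/-- The quantity `(n + p) ∫_K (v · x)₊^p dx`. -/
def momentIntegral {n : ℕ} (p : ℝ) (K : Set (EuclideanSpace ℝ (Fin n)))
    (v : EuclideanSpace ℝ (Fin n)) : ℝ :=
  (n + p) * ∫ x in K, max 0 (inner ℝ v x) ^ p

/-- The polar asymmetric `L_p` moment body `Z_p^{+,*} K`, as the unit ball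
`{v | ((n + p) ∫_K (v · x)₊^p dx)^{1/p} ≤ 1}`. -/
def polarMomentBody {n : ℕ} (p : ℝ) (K : Set (EuclideanSpace ℝ (Fin n))) :
    Set (EuclideanSpace ℝ (Fin n)) :=
  {v | momentIntegral p K v ^ (1 / p) ≤ 1}

/-- The asymmetric anisotropic fractional energy
`∫ ∫ (f(x) - f(y))₊^p / ‖x - y‖_K^{n + s p} dx dy`, with values in `[0, ∞]`; here `‖·‖_K`
is the Minkowski functional `gauge K`. -/
def asymFracEnergy {n : ℕ} (p s : ℝ) (K : Set (EuclideanSpace ℝ (Fin n)))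
    (f : EuclideanSpace ℝ (Fin n) → ℝ) : ℝ≥0∞ :=
  ∫⁻ y, ∫⁻ x, ENNReal.ofReal (max 0 (f x - f y) ^ p / gauge K (x - y) ^ (n + s * p))

/-- The anisotropic Sobolev energy `∫ ‖g(x)‖_L^p dx` of a vector field `g`, with values in
`[0, ∞]`, where `‖·‖_L` is the Minkowski functional `gauge L`. -/
def anisoEnergy {n : ℕ} (p : ℝ) (L : Set (EuclideanSpace ℝ (Fin n)))
    (g : EuclideanSpace ℝ (Fin n) → EuclideanSpace ℝ (Fin n)) : ℝ≥0∞ :=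
  ∫⁻ x, ENNReal.ofReal (gauge L (g x) ^ p)

end

/-! Put `Φ z = ∫ (f(y+z) - f(y))₊^p dy`. The substitution `x = y + z` and polar coordinates `z = r
u` turn the fractional energy into an integral over unit vectors `u` of `‖u‖_K^{-(n+sp)} ∫₀^∞
r^{-1-sp} Φ(ru) dr` (`lintegral_fracEnergy_eq`).

On `(0,1)` the kernel `(1-s) r^{-1-sp} r^p = (1-s) r^{p(1-s)-1}` has mass `1/p` and concentrates at
`r = 0` as `s → 1`, so only the limit of `Φ(ru)/r^p` at `0` survives. On `(1,∞)` the boundedness of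
`Φ` and the factor `1-s` remove the contribution (`tendsto_ofReal_mul_lintegral_rpow_mul`).

The limit of `Φ(ru)/r^p` is `∫ (∇f · u)₊^p`: an increment of `f` is the integral of its weak
gradient along the segment (`ae_sub_eq_integral_inner`), and translations are continuous in `L^p`
(`tendsto_lintegral_posPart_differenceQuotient`). The same formula gives `Φ(ru) ≤ r^p ‖∇f‖_p^p`,
which justifies dominated convergence over the sphere (`tendsto_fracEnergy`). Finally, polar
coordinates in `K` identify `∫ ‖u‖_K^{-(n+p)} (v · u)₊^p du` with `(n+p) ∫_K (v · x)₊^p dx`, the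
`p`-th power of the gauge of the moment body (`lintegral_ofReal_moment_eq`,
`gauge_polarMomentBody_rpow`). -/

/-! ### Increments of Sobolev functions along segments -/

section Sobolev

variable {E : Type*} [NormedAddCommGroup E] [InnerProductSpace ℝ E] [FiniteDimensional ℝ E]
  [MeasurableSpace E] [BorelSpace E]

/-- For `0 < t ≤ 1` the translate by `t • z` of the ball of radius `R` stays in the ball of radius
`R + ‖z‖`, where `f` is integrable. This feeds the Fubini arguments below. -/
lemma integrable_comp_add_smul {f : E → ℝ} (hf : LocallyIntegrable f volume) (hfm : Measurable f)
    (z : E) (R : ℝ) :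
    Integrable (fun q : E × ℝ => f (q.1 + q.2 • z))
      ((volume.restrict (Metric.closedBall 0 R)).prod (volume.restrict (Set.Ioc 0 1))) := by
  have hm : Measurable (fun q : E × ℝ => f (q.1 + q.2 • z)) := by fun_prop
  refine ⟨hm.aestronglyMeasurable, ?_⟩
  have hfin : ∫⁻ y in Metric.closedBall 0 (R + ‖z‖), ‖f y‖ₑ < ⊤ :=
    (hf.integrableOn_isCompact (isCompact_closedBall (0 : E) (R + ‖z‖))).2
  rw [hasFiniteIntegral_def, lintegral_prod_symm _ hm.enorm.aemeasurable]
  have hle : ∀ t ∈ Set.Ioc (0 : ℝ) 1,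
      ∫⁻ y in Metric.closedBall 0 R, ‖f (y + t • z)‖ₑ ≤
        ∫⁻ y in Metric.closedBall 0 (R + ‖z‖), ‖f y‖ₑ := by
    intro t ht
    rw [← lintegral_indicator Metric.isClosed_closedBall.measurableSet,
      ← lintegral_indicator Metric.isClosed_closedBall.measurableSet,
      ← lintegral_add_right_eq_self
        ((Metric.closedBall (0 : E) (R + ‖z‖)).indicator fun y => ‖f y‖ₑ) (t • z)]
    refine lintegral_mono fun y => ?_
    by_cases hy : y ∈ Metric.closedBall (0 : E) R
    · have : y + t • z ∈ Metric.closedBall (0 : E) (R + ‖z‖) := by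
        simp only [mem_closedBall_zero_iff] at hy ⊢
        refine (norm_add_le _ _).trans (add_le_add hy ?_)
        rw [norm_smul, Real.norm_of_nonneg ht.1.le]
        exact mul_le_of_le_one_left (norm_nonneg _) ht.2
      simp [Set.indicator_of_mem hy, Set.indicator_of_mem this]
    · simp [Set.indicator_of_notMem hy]
  calc ∫⁻ t in Set.Ioc (0 : ℝ) 1, ∫⁻ y in Metric.closedBall 0 R, ‖f (y + t • z)‖ₑ
      ≤ ∫⁻ _ in Set.Ioc (0 : ℝ) 1, ∫⁻ y in Metric.closedBall 0 (R + ‖z‖), ‖f y‖ₑ :=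
        setLIntegral_mono measurable_const hle
    _ < ⊤ := by simpa using hfin

lemma locallyIntegrable_integral_comp_add_smul {f : E → ℝ} (hf : LocallyIntegrable f volume)
    (hfm : Measurable f) (z : E) :
    LocallyIntegrable (fun y => ∫ t in Set.Ioc (0 : ℝ) 1, f (y + t • z)) volume := by
  rw [locallyIntegrable_iff]
  intro k hk
  obtain ⟨R, hR⟩ := hk.isBounded.subset_closedBall (0 : E)
  exact IntegrableOn.mono_set (integrable_comp_add_smul hf hfm z R).integral_prod_left hR

lemma integrable_mul_comp_add_smul {f : E → ℝ} (hf : LocallyIntegrable f volume)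
    (hfm : Measurable f) (z : E) {ψ : E → ℝ} (hψ : Continuous ψ) (hc : HasCompactSupport ψ) :
    Integrable (fun q : E × ℝ => f (q.1 + q.2 • z) * ψ q.1)
      ((volume : Measure E).prod (volume.restrict (Set.Ioc 0 1))) := by
  obtain ⟨R, hR⟩ := hc.isCompact.isBounded.subset_closedBall (0 : E)
  obtain ⟨M, hM⟩ := hψ.bounded_above_of_compact_support hc
  have h1 : Integrable (fun q : E × ℝ => f (q.1 + q.2 • z) * ψ q.1)
      ((volume.restrict (Metric.closedBall (0 : E) R)).prod (volume.restrict (Set.Ioc 0 1))) :=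
    (integrable_comp_add_smul hf hfm z R).mul_bdd (c := M) (by fun_prop)
      (Eventually.of_forall fun q => hM q.1)
  have h2 : (volume.restrict (Metric.closedBall (0 : E) R)).prod
      (volume.restrict (Set.Ioc (0 : ℝ) 1)) =
      ((volume : Measure E).prod (volume.restrict (Set.Ioc (0 : ℝ) 1))).restrict
        (Metric.closedBall (0 : E) R ×ˢ Set.univ) := by
    rw [← Measure.prod_restrict, Measure.restrict_univ]
  rw [h2] at h1
  refine (integrableOn_iff_integrable_of_support_subset ?_).1 h1
  intro q hq
  refine ⟨?_, trivial⟩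
  by_contra hn
  exact hq (by simp [image_eq_zero_of_notMem_tsupport fun h => hn (hR h)])

lemma integral_comp_add_smul_mul {f : E → ℝ} (z : E) (ψ : E → ℝ) (t : ℝ) :
    ∫ y, f (y + t • z) * ψ y = ∫ y, f y * ψ (y - t • z) := by
  rw [← integral_add_right_eq_self (fun y => f y * ψ (y - t • z)) (t • z)]
  simp

/-- The increment of a Sobolev function along `z` is the integral of its weak gradient. -/
lemma ae_sub_eq_integral_inner {f : E → ℝ} {g : E → E} (hf : LocallyIntegrable f volume)
    (hfm : Measurable f) (hg : LocallyIntegrable g volume) (hgm : Measurable g)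
    (hfg : ∀ φ : E → ℝ, ContDiff ℝ ∞ φ → HasCompactSupport φ →
      ∀ z : E, ∫ x, f x * fderiv ℝ φ x z = - ∫ x, inner ℝ (g x) z * φ x) (z : E) :
    ∀ᵐ y, f (y + z) - f y = ∫ t in Set.Ioc (0 : ℝ) 1, inner ℝ (g (y + t • z)) z := by
  have hgz : LocallyIntegrable (fun y => inner ℝ (g y) z) volume := by
    rw [locallyIntegrable_iff] at hg ⊢
    intro k hk
    exact (hg k hk).inner_const z
  have hgzm : Measurable (fun y => inner ℝ (g y) z) := by fun_prop
  have hfz : LocallyIntegrable (fun y => f (y + z)) volume := by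
    rw [locallyIntegrable_iff] at hf ⊢
    intro k hk
    have := hf _ (hk.image (continuous_add_const z))
    have e : MeasurableEmbedding (fun y : E => y + z) := measurableEmbedding_addRight z
    exact ((measurePreserving_add_right volume z).integrableOn_image e).1 this
  -- Both sides are locally integrable, so it suffices to test against smooth `φ`. The translation
  -- is moved onto `φ`, where the fundamental theorem of calculus is classical, and the weak
  -- gradient is then applied to translates of `φ`.
  refine ae_eq_of_integral_contDiff_smul_eq (hfz.sub hf)
    (locallyIntegrable_integral_comp_add_smul hgz hgzm z) ?_
  intro φ hφ hc
  have hφc : Continuous φ := hφ.continuous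
  have hdc : Continuous (fun y => fderiv ℝ φ y z) :=
    (hφ.continuous_fderiv (by simp)).clm_apply continuous_const
  have hds : HasCompactSupport (fun y => fderiv ℝ φ y z) := hc.fderiv_apply (𝕜 := ℝ) z
  have hint : ∀ {h : E → ℝ}, LocallyIntegrable h volume →
      Integrable (fun y => h y * φ y) volume := fun hh => by
    simpa [mul_comm] using hh.integrable_smul_left_of_hasCompactSupport hφc hc
  have htrans : ∀ t : ℝ, ContDiff ℝ ∞ (fun y => φ (y - t • z)) ∧
      HasCompactSupport (fun y => φ (y - t • z)) := fun t =>
    ⟨hφ.comp (contDiff_id.sub contDiff_const),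
      hc.comp_homeomorph (Homeomorph.subRight (t • z))⟩
  have hfd : ∀ (t : ℝ) (y : E), fderiv ℝ φ (y - t • z) z =
      fderiv ℝ (fun y => φ (y - t • z)) y z := fun t y => by
    rw [fderiv_comp_sub]
  have hline : ∀ y : E, φ (y - z) - φ y = - ∫ t in Set.Ioc (0 : ℝ) 1, fderiv ℝ φ (y - t • z) z := by
    intro y
    have hder : ∀ t : ℝ, HasDerivAt (fun t : ℝ => φ (y - t • z)) (-(fderiv ℝ φ (y - t • z) z)) t := by
      intro t
      have h1 : HasDerivAt (fun t : ℝ => y - t • z) (-z) t := by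
        simpa using ((hasDerivAt_id t).smul_const z).const_sub y
      have h2 := ((hφ.differentiable (by simp)) (y - t • z)).hasFDerivAt.comp_hasDerivAt t h1
      rw [map_neg] at h2
      exact h2
    have hci : Continuous fun t : ℝ => fderiv ℝ φ (y - t • z) z :=
      hdc.comp (by fun_prop : Continuous fun t : ℝ => y - t • z)
    have := intervalIntegral.integral_eq_sub_of_hasDerivAt (a := 0) (b := 1)
      (fun t _ => hder t) (hci.neg.intervalIntegrable _ _)
    rw [intervalIntegral.integral_of_le zero_le_one, integral_neg] at this
    simpa using this.symm
  -- `f` is only locally integrable, so it is truncated to the ball of radius `R + ‖z‖`. Outside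
  -- that ball the derivative of `φ` at `y - t • z` vanishes for all `t` in `(0,1]`.
  have hA' : Integrable (fun q : E × ℝ => f q.1 * fderiv ℝ φ (q.1 - q.2 • z) z)
      ((volume : Measure E).prod (volume.restrict (Set.Ioc 0 1))) := by
    obtain ⟨R, hR⟩ := hds.isCompact.isBounded.subset_closedBall (0 : E)
    obtain ⟨M, hM⟩ := hdc.bounded_above_of_compact_support hds
    set S := Metric.closedBall (0 : E) (R + ‖z‖) with hS
    have h1 : Integrable (S.indicator f) volume :=
      (hf.integrableOn_isCompact (isCompact_closedBall _ _)).integrable_indicator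
        Metric.isClosed_closedBall.measurableSet
    have h2 : Integrable (fun q : E × ℝ => S.indicator f q.1 * fderiv ℝ φ (q.1 - q.2 • z) z)
        ((volume : Measure E).prod (volume.restrict (Set.Ioc 0 1))) :=
      (h1.comp_fst _).mul_bdd (c := M)
        (hdc.comp (by fun_prop : Continuous fun q : E × ℝ => q.1 - q.2 • z)).aestronglyMeasurable
        (Eventually.of_forall fun q => hM _)
    refine h2.congr ?_
    have h3 : (volume : Measure E).prod (volume.restrict (Set.Ioc (0 : ℝ) 1)) =
        ((volume : Measure E).prod volume).restrict (Set.univ ×ˢ Set.Ioc (0 : ℝ) 1) := by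
      rw [← Measure.prod_restrict, Measure.restrict_univ]
    rw [h3]
    filter_upwards [ae_restrict_mem (MeasurableSet.univ.prod measurableSet_Ioc)] with q hq
    by_cases hy : q.1 ∈ S
    · simp [Set.indicator_of_mem hy]
    · have : fderiv ℝ φ (q.1 - q.2 • z) z = 0 := by
        by_contra hn
        have hmem := hR (subset_tsupport _ (Function.mem_support.2 hn))
        apply hy
        rw [hS]
        simp only [mem_closedBall_zero_iff] at hmem ⊢
        have h4 : ‖q.2 • z‖ ≤ ‖z‖ := by
          rw [norm_smul, Real.norm_of_nonneg hq.2.1.le]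
          exact mul_le_of_le_one_left (norm_nonneg _) hq.2.2
        calc ‖q.1‖ = ‖(q.1 - q.2 • z) + q.2 • z‖ := by rw [sub_add_cancel]
          _ ≤ R + ‖z‖ := (norm_add_le _ _).trans (add_le_add hmem h4)
      simp [this]
  have hB := integrable_mul_comp_add_smul hgz hgzm z hφc hc
  calc ∫ y, φ y • (f (y + z) - f y)
      = (∫ y, f (y + (1 : ℝ) • z) * φ y) - ∫ y, f y * φ y := by
        rw [← integral_sub (by simpa using hint hfz) (hint hf)]
        congr 1 with y
        simp; ring
    _ = ∫ y, f y * (φ (y - z) - φ y) := by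
        rw [integral_comp_add_smul_mul, ← integral_sub _ (hint hf)]
        · congr 1 with y
          simp; ring
        · simpa [mul_comm] using hf.integrable_smul_left_of_hasCompactSupport
            (htrans 1).1.continuous (htrans 1).2
    _ = - ∫ y, ∫ t in Set.Ioc (0 : ℝ) 1, f y * fderiv ℝ φ (y - t • z) z := by
        rw [← integral_neg]
        congr 1 with y
        rw [hline, integral_const_mul]; ring
    _ = - ∫ t in Set.Ioc (0 : ℝ) 1, ∫ y, f y * fderiv ℝ φ (y - t • z) z := by
        rw [integral_integral_swap hA']
    _ = ∫ t in Set.Ioc (0 : ℝ) 1, ∫ y, inner ℝ (g (y + t • z)) z * φ y := by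
        rw [← integral_neg]
        congr 1 with t
        simp_rw [hfd]
        rw [hfg _ (htrans t).1 (htrans t).2 z, neg_neg,
          integral_comp_add_smul_mul (f := fun y => inner ℝ (g y) z)]
    _ = ∫ y, ∫ t in Set.Ioc (0 : ℝ) 1, inner ℝ (g (y + t • z)) z * φ y :=
        (integral_integral_swap hB).symm
    _ = ∫ y, φ y • ∫ t in Set.Ioc (0 : ℝ) 1, inner ℝ (g (y + t • z)) z := by
        congr 1 with y
        rw [integral_mul_const, smul_eq_mul, mul_comm]

end Sobolev

/-! ### `L^p` bounds and the limit of difference quotients -/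

section LpEstimates

lemma ofReal_max_zero_rpow {p : ℝ} (hp : 0 ≤ p) (x : ℝ) :
    ENNReal.ofReal (max 0 x ^ p) = ‖max 0 x‖ₑ ^ p := by
  rw [Real.enorm_of_nonneg (le_max_left _ _), ENNReal.ofReal_rpow_of_nonneg (le_max_left _ _) hp]

lemma ofReal_max_zero_rpow_le {p : ℝ} (hp : 0 ≤ p) (x : ℝ) :
    ENNReal.ofReal (max 0 x ^ p) ≤ ‖x‖ₑ ^ p := by
  rw [ofReal_max_zero_rpow hp]
  gcongr
  rw [Real.enorm_eq_ofReal_abs, Real.enorm_eq_ofReal_abs]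
  apply ENNReal.ofReal_le_ofReal
  rw [abs_of_nonneg (le_max_left _ _)]
  exact max_le (abs_nonneg _) (le_abs_self _)

lemma lintegral_rpow_le_of_isProbabilityMeasure {α : Type*} [MeasurableSpace α] {μ : Measure α}
    [IsProbabilityMeasure μ] {p : ℝ} (hp : 1 ≤ p) {h : α → ℝ} (hm : AEStronglyMeasurable h μ) :
    (∫⁻ a, ‖h a‖ₑ ∂μ) ^ p ≤ ∫⁻ a, ‖h a‖ₑ ^ p ∂μ := by
  have h0 : 0 < p := zero_lt_one.trans_le hp
  have := eLpNorm'_le_eLpNorm'_of_exponent_le zero_lt_one hp μ hm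
  rw [eLpNorm'_eq_lintegral_enorm, eLpNorm'_eq_lintegral_enorm] at this
  simp only [ENNReal.rpow_one, div_one, one_div] at this
  rwa [ENNReal.le_rpow_inv_iff h0] at this

/-- The interval has length one, so Jensen's inequality costs no constant. -/
lemma enorm_setIntegral_Ioc_rpow_le {p : ℝ} (hp : 1 ≤ p) {h : ℝ → ℝ} (hm : Measurable h) :
    ‖∫ t in Set.Ioc (0 : ℝ) 1, h t‖ₑ ^ p ≤ ∫⁻ t in Set.Ioc (0 : ℝ) 1, ‖h t‖ₑ ^ p := by
  have : IsProbabilityMeasure (volume.restrict (Set.Ioc (0 : ℝ) 1)) := ⟨by simp⟩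
  refine le_trans ?_ (lintegral_rpow_le_of_isProbabilityMeasure hp hm.aestronglyMeasurable)
  gcongr
  exact enorm_integral_le_lintegral_enorm _

/-- Two triangle inequalities squeeze the norm of `F i` around that of `F₀`. The lower one uses
truncated subtraction in `ℝ≥0∞`, continuous here because the norm of `F₀` is finite. -/
lemma tendsto_lintegral_enorm_rpow {α ι : Type*} [MeasurableSpace α] {μ : Measure α} {l : Filter ι}
    {p : ℝ} (hp : 1 ≤ p) {F : ι → α → ℝ} {F₀ : α → ℝ} (hF : ∀ i, AEStronglyMeasurable (F i) μ)
    (hF₀ : AEStronglyMeasurable F₀ μ) (hfin : ∫⁻ a, ‖F₀ a‖ₑ ^ p ∂μ ≠ ⊤)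
    (h : Tendsto (fun i => ∫⁻ a, ‖F i a - F₀ a‖ₑ ^ p ∂μ) l (𝓝 0)) :
    Tendsto (fun i => ∫⁻ a, ‖F i a‖ₑ ^ p ∂μ) l (𝓝 (∫⁻ a, ‖F₀ a‖ₑ ^ p ∂μ)) := by
  have h0 : 0 < p := zero_lt_one.trans_le hp
  have hpow : ∀ G : α → ℝ, ∫⁻ a, ‖G a‖ₑ ^ p ∂μ = eLpNorm' G p μ ^ p := fun G => by
    rw [eLpNorm'_eq_lintegral_enorm, one_div, ENNReal.rpow_inv_rpow h0.ne']
  have hd : Tendsto (fun i => eLpNorm' (F i - F₀) p μ) l (𝓝 0) := by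
    have := h.ennrpow_const (1 / p)
    rw [ENNReal.zero_rpow_of_pos (by positivity)] at this
    simpa [eLpNorm'_eq_lintegral_enorm] using this
  have hb : eLpNorm' F₀ p μ ≠ ⊤ := by
    rw [hpow] at hfin
    intro hh
    exact hfin (by rw [hh, ENNReal.top_rpow_of_pos h0])
  simp_rw [hpow]
  refine Tendsto.ennrpow_const p ?_
  have hup : Tendsto (fun i => eLpNorm' F₀ p μ + eLpNorm' (F i - F₀) p μ) l
      (𝓝 (eLpNorm' F₀ p μ)) := by simpa using hd.const_add (eLpNorm' F₀ p μ)
  have hlo : Tendsto (fun i => eLpNorm' F₀ p μ - eLpNorm' (F i - F₀) p μ) l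
      (𝓝 (eLpNorm' F₀ p μ)) := by
    simpa using ENNReal.Tendsto.sub tendsto_const_nhds hd (Or.inl hb)
  refine tendsto_of_tendsto_of_tendsto_of_le_of_le hlo hup (fun i => ?_) (fun i => ?_)
  · rw [tsub_le_iff_right]
    have := eLpNorm'_add_le (hF i) (hF₀.sub (hF i)) hp
    have e : eLpNorm' (F₀ - F i) p μ = eLpNorm' (F i - F₀) p μ := by
      rw [← neg_sub, eLpNorm'_neg]
    rw [e] at this
    simpa using this
  · have := eLpNorm'_add_le hF₀ ((hF i).sub hF₀) hp
    simpa using this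

lemma enorm_inner_rpow_le {E : Type*} [NormedAddCommGroup E] [InnerProductSpace ℝ E] {p : ℝ} (hp : 0 ≤ p) (x z : E) :
    ‖inner ℝ x z‖ₑ ^ p ≤ ‖z‖ₑ ^ p * ‖x‖ₑ ^ p := by
  rw [← ENNReal.mul_rpow_of_nonneg _ _ hp]
  gcongr
  rw [← ofReal_norm, ← ofReal_norm, ← ofReal_norm,
    ← ENNReal.ofReal_mul (norm_nonneg _), mul_comm]
  exact ENNReal.ofReal_le_ofReal (norm_inner_le_norm _ _)

variable {E : Type*} [NormedAddCommGroup E] [InnerProductSpace ℝ E] [FiniteDimensional ℝ E]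
  [MeasurableSpace E] [BorelSpace E]

lemma tendsto_lintegral_translate_sub {p : ℝ} (hp : 1 ≤ p) {g : E → E}
    (hg : MemLp g (ENNReal.ofReal p) volume) :
    Tendsto (fun z : E => ∫⁻ y, ‖g (y + z) - g y‖ₑ ^ p) (𝓝 0) (𝓝 0) := by
  have h0 : 0 < p := zero_lt_one.trans_le hp
  have : Fact (1 ≤ ENNReal.ofReal p) := ⟨by simpa using hp⟩
  have : Fact (ENNReal.ofReal p ≠ ⊤) := ⟨ENNReal.ofReal_ne_top⟩
  have hc : Continuous fun z : E => (DomAddAct.mk z) +ᵥ hg.toLp g :=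
    (DomAddAct.continuous_mk).vadd continuous_const
  have ht := (hc.tendsto 0).edist (tendsto_const_nhds (x := hg.toLp g))
  have h1 : (DomAddAct.mk (0 : E)) +ᵥ hg.toLp g = hg.toLp g := zero_vadd _ _
  rw [h1, edist_self] at ht
  have ht' := ht.ennrpow_const p
  rw [ENNReal.zero_rpow_of_pos h0] at ht'
  refine ht'.congr fun z => ?_
  rw [DomAddAct.mk_vadd_toLp, Lp.edist_toLp_toLp, eLpNorm_eq_lintegral_rpow_enorm_toReal
    (by simpa using h0) ENNReal.ofReal_ne_top, ENNReal.toReal_ofReal h0.le, one_div,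
    ENNReal.rpow_inv_rpow h0.ne']
  simp [add_comm]

lemma lintegral_enorm_rpow_lt_top {F : Type*} [NormedAddCommGroup F] {p : ℝ} (hp : 1 ≤ p)
    {g : E → F} (hg : MemLp g (ENNReal.ofReal p) volume) : ∫⁻ y, ‖g y‖ₑ ^ p < ⊤ := by
  have h0 : 0 < p := zero_lt_one.trans_le hp
  have := lintegral_rpow_enorm_lt_top_of_eLpNorm_lt_top (by simpa using h0)
    ENNReal.ofReal_ne_top hg.2
  rwa [ENNReal.toReal_ofReal h0.le] at this

variable {f : E → ℝ} {g : E → E} {p : ℝ}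

/-- Jensen and Cauchy–Schwarz are applied to the increment formula; Tonelli and translation
invariance then remove the shift. -/
lemma lintegral_enorm_translate_sub_rpow_le (hp : 1 ≤ p) (hgm : Measurable g) {z : E}
    (hinc : ∀ᵐ y, f (y + z) - f y = ∫ t in Set.Ioc (0 : ℝ) 1, inner ℝ (g (y + t • z)) z) :
    ∫⁻ y, ‖f (y + z) - f y‖ₑ ^ p ≤ ‖z‖ₑ ^ p * ∫⁻ y, ‖g y‖ₑ ^ p := by
  have h0 : 0 ≤ p := zero_le_one.trans hp
  calc ∫⁻ y, ‖f (y + z) - f y‖ₑ ^ p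
      ≤ ∫⁻ y, ∫⁻ t in Set.Ioc (0 : ℝ) 1, ‖z‖ₑ ^ p * ‖g (y + t • z)‖ₑ ^ p := by
        refine lintegral_mono_ae (hinc.mono fun y hy => ?_)
        rw [hy]
        refine (enorm_setIntegral_Ioc_rpow_le hp (by fun_prop)).trans ?_
        exact lintegral_mono fun t => enorm_inner_rpow_le h0 _ _
    _ = ∫⁻ t in Set.Ioc (0 : ℝ) 1, ∫⁻ y, ‖z‖ₑ ^ p * ‖g (y + t • z)‖ₑ ^ p :=
        lintegral_lintegral_swap (by fun_prop)
    _ = ‖z‖ₑ ^ p * ∫⁻ y, ‖g y‖ₑ ^ p := by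
        have : ∀ t : ℝ, ∫⁻ y, ‖z‖ₑ ^ p * ‖g (y + t • z)‖ₑ ^ p =
            ‖z‖ₑ ^ p * ∫⁻ y, ‖g y‖ₑ ^ p := fun t => by
          rw [lintegral_add_right_eq_self (fun y => ‖z‖ₑ ^ p * ‖g y‖ₑ ^ p) (t • z),
            lintegral_const_mul _ (by fun_prop)]
        simp [this]

/-- The first-order remainder is the mean of `⟨g (y + t • z) - g y, z⟩` over `t`. The right side is
`o(‖z‖^p)` once translations are continuous in `L^p`. -/
lemma lintegral_enorm_linearization_rpow_le (hp : 1 ≤ p) (hgm : Measurable g)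
    (hg : LocallyIntegrable g volume) {z : E}
    (hinc : ∀ᵐ y, f (y + z) - f y = ∫ t in Set.Ioc (0 : ℝ) 1, inner ℝ (g (y + t • z)) z) :
    ∫⁻ y, ‖f (y + z) - f y - inner ℝ (g y) z‖ₑ ^ p ≤
      ‖z‖ₑ ^ p * ∫⁻ t in Set.Ioc (0 : ℝ) 1, ∫⁻ y, ‖g (y + t • z) - g y‖ₑ ^ p := by
  have h0 : 0 ≤ p := zero_le_one.trans hp
  have hgz : LocallyIntegrable (fun y => inner ℝ (g y) z) volume := by
    rw [locallyIntegrable_iff] at hg ⊢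
    intro k hk
    exact (hg k hk).inner_const z
  have hint : ∀ᵐ y, IntegrableOn (fun t : ℝ => inner ℝ (g (y + t • z)) z)
      (Set.Ioc (0 : ℝ) 1) volume := by
    -- Integrability along almost every segment comes from Fubini on balls; countably many balls
    -- exhaust the space.
    have h1 : ∀ R : ℕ, ∀ᵐ y, y ∈ Metric.closedBall (0 : E) R →
        IntegrableOn (fun t : ℝ => inner ℝ (g (y + t • z)) z) (Set.Ioc (0 : ℝ) 1) volume := by
      intro R
      rw [← ae_restrict_iff' Metric.isClosed_closedBall.measurableSet]
      exact (integrable_comp_add_smul hgz (by fun_prop) z R).prod_right_ae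
    filter_upwards [ae_all_iff.2 h1] with y hy
    obtain ⟨R, hR⟩ := exists_nat_ge ‖y‖
    exact hy R (by simpa using hR)
  calc ∫⁻ y, ‖f (y + z) - f y - inner ℝ (g y) z‖ₑ ^ p
      ≤ ∫⁻ y, ∫⁻ t in Set.Ioc (0 : ℝ) 1, ‖z‖ₑ ^ p * ‖g (y + t • z) - g y‖ₑ ^ p := by
        refine lintegral_mono_ae ?_
        filter_upwards [hinc, hint] with y hy hyi
        have : f (y + z) - f y - inner ℝ (g y) z =
            ∫ t in Set.Ioc (0 : ℝ) 1, inner ℝ (g (y + t • z) - g y) z := by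
          simp_rw [inner_sub_left]
          rw [integral_sub hyi (integrable_const _), hy]
          simp
        rw [this]
        refine (enorm_setIntegral_Ioc_rpow_le hp (by fun_prop)).trans ?_
        exact lintegral_mono fun t => enorm_inner_rpow_le h0 _ _
    _ = ∫⁻ t in Set.Ioc (0 : ℝ) 1, ∫⁻ y, ‖z‖ₑ ^ p * ‖g (y + t • z) - g y‖ₑ ^ p :=
        lintegral_lintegral_swap (by fun_prop)
    _ = ‖z‖ₑ ^ p * ∫⁻ t in Set.Ioc (0 : ℝ) 1, ∫⁻ y, ‖g (y + t • z) - g y‖ₑ ^ p := by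
        rw [← lintegral_const_mul' _ _ (by finiteness)]
        congr 1 with t
        rw [lintegral_const_mul _ (by fun_prop)]

/-- Convergence of the difference quotients of a Sobolev function in direction `u` to the
directional derivative, for the positive parts of the `L^p` norms. -/
lemma tendsto_lintegral_posPart_differenceQuotient (hp : 1 ≤ p) (hfm : Measurable f)
    (hgm : Measurable g) (hg : LocallyIntegrable g volume)
    (hgp : MemLp g (ENNReal.ofReal p) volume)
    (hinc : ∀ z : E, ∀ᵐ y,
      f (y + z) - f y = ∫ t in Set.Ioc (0 : ℝ) 1, inner ℝ (g (y + t • z)) z) (u : E) :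
    Tendsto (fun r : ℝ => (∫⁻ y, ENNReal.ofReal (max 0 (f (y + r • u) - f y) ^ p)) /
      ENNReal.ofReal (r ^ p)) (𝓝[>] 0)
      (𝓝 (∫⁻ y, ENNReal.ofReal (max 0 (inner ℝ (g y) u) ^ p))) := by
  have h0 : 0 < p := zero_lt_one.trans_le hp
  simp_rw [ofReal_max_zero_rpow h0.le]
  -- By homogeneity the factor `1/r^p` moves inside the positive part. Since `max 0 ·` is
  -- 1-Lipschitz, convergence of the quotients in `L^p` passes to positive parts.
  have hmain : Tendsto (fun r : ℝ => ∫⁻ y, ‖max 0 (r⁻¹ * (f (y + r • u) - f y))‖ₑ ^ p) (𝓝[>] 0)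
      (𝓝 (∫⁻ y, ‖max 0 (inner ℝ (g y) u)‖ₑ ^ p)) := by
    refine tendsto_lintegral_enorm_rpow hp (fun r => by fun_prop) (by fun_prop) ?_ ?_
    · refine ne_top_of_le_ne_top (b := ‖u‖ₑ ^ p * ∫⁻ y, ‖g y‖ₑ ^ p) ?_ ?_
      · exact ENNReal.mul_ne_top (by finiteness) (lintegral_enorm_rpow_lt_top hp hgp).ne
      · rw [← lintegral_const_mul _ (by fun_prop)]
        refine lintegral_mono fun y => le_trans ?_ (enorm_inner_rpow_le h0.le _ _)
        rw [← ofReal_max_zero_rpow h0.le]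
        exact ofReal_max_zero_rpow_le h0.le _
    · have hT := tendsto_lintegral_translate_sub hp hgp
      rw [ENNReal.tendsto_nhds_zero] at hT ⊢
      intro ε hε
      -- The added `1` keeps the divisor nonzero when `u = 0`.
      have hcpos : ‖u‖ₑ ^ p + 1 ≠ 0 := by simp
      have hctop : ‖u‖ₑ ^ p + 1 ≠ ⊤ := by finiteness
      have hev := hT (ε / (‖u‖ₑ ^ p + 1)) (ENNReal.div_pos hε.ne' hctop)
      obtain ⟨δ, hδ, hball⟩ := Metric.eventually_nhds_iff.1 hev
      have hsmall : ∀ᶠ r : ℝ in 𝓝[>] 0, ‖r • u‖ < δ := by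
        have : Tendsto (fun r : ℝ => ‖r • u‖) (𝓝 0) (𝓝 0) := by
          have : Continuous fun r : ℝ => ‖r • u‖ := by fun_prop
          simpa using this.tendsto 0
        exact (this.eventually_lt_const hδ).filter_mono nhdsWithin_le_nhds
      filter_upwards [hsmall, self_mem_nhdsWithin] with r hr hr0
      have hr0 : 0 < r := hr0
      have hre : ‖r⁻¹‖ₑ ^ p * ‖r • u‖ₑ ^ p = ‖u‖ₑ ^ p := by
        rw [← ENNReal.mul_rpow_of_nonneg _ _ h0.le, ← enorm_smul, smul_smul,
          inv_mul_cancel₀ hr0.ne', one_smul]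
      calc ∫⁻ y, ‖max 0 (r⁻¹ * (f (y + r • u) - f y)) - max 0 (inner ℝ (g y) u)‖ₑ ^ p
          ≤ ∫⁻ y, ‖r⁻¹‖ₑ ^ p * ‖f (y + r • u) - f y - inner ℝ (g y) (r • u)‖ₑ ^ p := by
            refine lintegral_mono fun y => ?_
            simp only []
            rw [← ENNReal.mul_rpow_of_nonneg _ _ h0.le, ← enorm_mul]
            gcongr
            have e : r⁻¹ * (f (y + r • u) - f y - inner ℝ (g y) (r • u)) =
                r⁻¹ * (f (y + r • u) - f y) - inner ℝ (g y) u := by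
              rw [inner_smul_right]; field_simp
            rw [e, Real.enorm_eq_ofReal_abs, Real.enorm_eq_ofReal_abs]
            apply ENNReal.ofReal_le_ofReal
            simpa [max_comm] using abs_max_sub_max_le_abs (r⁻¹ * (f (y + r • u) - f y))
              (inner ℝ (g y) u) 0
        _ = ‖r⁻¹‖ₑ ^ p * ∫⁻ y, ‖f (y + r • u) - f y - inner ℝ (g y) (r • u)‖ₑ ^ p :=
            lintegral_const_mul _ (by fun_prop)
        _ ≤ ‖r⁻¹‖ₑ ^ p * (‖r • u‖ₑ ^ p *
              ∫⁻ t in Set.Ioc (0 : ℝ) 1, ∫⁻ y, ‖g (y + t • r • u) - g y‖ₑ ^ p) := by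
            gcongr
            exact lintegral_enorm_linearization_rpow_le hp hgm hg (hinc _)
        _ ≤ ‖u‖ₑ ^ p * ∫⁻ t in Set.Ioc (0 : ℝ) 1, ε / (‖u‖ₑ ^ p + 1) := by
            rw [← mul_assoc, hre]
            refine mul_le_mul' le_rfl ?_
            refine setLIntegral_mono measurable_const fun t ht => hball ?_
            rw [dist_zero_right, norm_smul, Real.norm_of_nonneg ht.1.le]
            exact (mul_le_of_le_one_left (norm_nonneg _) ht.2).trans_lt hr
        _ ≤ (‖u‖ₑ ^ p + 1) * (ε / (‖u‖ₑ ^ p + 1)) := by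
            simp only [lintegral_const, Measure.restrict_apply_univ, Real.volume_Ioc, sub_zero,
              ENNReal.ofReal_one, mul_one]
            gcongr
            exact le_self_add
        _ = ε := ENNReal.mul_div_cancel hcpos hctop
  refine hmain.congr' ?_
  filter_upwards [self_mem_nhdsWithin] with r hr
  have hr : 0 < r := hr
  have hrp : ‖r⁻¹‖ₑ ^ p = (ENNReal.ofReal (r ^ p))⁻¹ := by
    rw [enorm_inv hr.ne', ENNReal.inv_rpow, Real.enorm_of_nonneg hr.le,
      ENNReal.ofReal_rpow_of_nonneg hr.le h0.le]
  rw [div_eq_mul_inv, mul_comm, ← hrp, ← lintegral_const_mul _ (by fun_prop)]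
  congr 1 with y
  rw [← ENNReal.mul_rpow_of_nonneg _ _ h0.le, ← enorm_mul, mul_max_of_nonneg _ _ (by positivity),
    mul_zero]

/-- A bound uniform in `z`, for use at large `r`, where the bound by `r^p` would leave a divergent
radial integral. -/
lemma lintegral_posPart_increment_le (hp : 1 ≤ p) (hfm : Measurable f) (z : E) :
    ∫⁻ y, ENNReal.ofReal (max 0 (f (y + z) - f y) ^ p) ≤
      2 ^ (p - 1) * ((∫⁻ y, ‖f y‖ₑ ^ p) + ∫⁻ y, ‖f y‖ₑ ^ p) := by
  have h0 : 0 ≤ p := zero_le_one.trans hp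
  calc ∫⁻ y, ENNReal.ofReal (max 0 (f (y + z) - f y) ^ p)
      ≤ ∫⁻ y, 2 ^ (p - 1) * (‖f (y + z)‖ₑ ^ p + ‖f y‖ₑ ^ p) := by
        refine lintegral_mono fun y => (ofReal_max_zero_rpow_le h0 _).trans ?_
        refine le_trans ?_ (ENNReal.rpow_add_le_mul_rpow_add_rpow _ _ hp)
        gcongr
        exact enorm_sub_le
    _ = 2 ^ (p - 1) * ((∫⁻ y, ‖f y‖ₑ ^ p) + ∫⁻ y, ‖f y‖ₑ ^ p) := by
        rw [lintegral_const_mul _ (by fun_prop), lintegral_add_left (by fun_prop),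
          lintegral_add_right_eq_self (fun y => ‖f y‖ₑ ^ p) z]

lemma measurable_lintegral_posPart_increment (hfm : Measurable f) :
    Measurable fun z : E => ∫⁻ y, ENNReal.ofReal (max 0 (f (y + z) - f y) ^ p) :=
  Measurable.lintegral_prod_right' (f := fun q : E × E =>
    ENNReal.ofReal (max 0 (f (q.2 + q.1) - f q.2) ^ p)) (by fun_prop)

lemma lintegral_posPart_inner_le (hp : 0 ≤ p) (hgm : Measurable g) (u : E) :
    ∫⁻ y, ENNReal.ofReal (max 0 (inner ℝ (g y) u) ^ p) ≤ ‖u‖ₑ ^ p * ∫⁻ y, ‖g y‖ₑ ^ p := by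
  rw [← lintegral_const_mul _ (by fun_prop)]
  exact lintegral_mono fun y =>
    (ofReal_max_zero_rpow_le hp _).trans (enorm_inner_rpow_le hp _ _)

end LpEstimates

/-! ### Concentration of the radial kernel as `s → 1` -/

section RadialLimit

/-- The substitution `t = r ^ a` on the unit interval. -/
lemma lintegral_Ioo_rpow_sub_one_mul {a : ℝ} (ha : 0 < a) (ψ : ℝ → ℝ≥0∞) :
    ∫⁻ r in Set.Ioo (0 : ℝ) 1, ENNReal.ofReal (a * r ^ (a - 1)) * ψ r =
      ∫⁻ t in Set.Ioo (0 : ℝ) 1, ψ (t ^ a⁻¹) := by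
  have himg : (fun r : ℝ => r ^ a) '' Set.Ioo 0 1 = Set.Ioo 0 1 := by
    ext t
    constructor
    · rintro ⟨r, hr, rfl⟩
      exact ⟨Real.rpow_pos_of_pos hr.1 _, Real.rpow_lt_one hr.1.le hr.2 ha⟩
    · intro ht
      refine ⟨t ^ a⁻¹, ⟨Real.rpow_pos_of_pos ht.1 _, Real.rpow_lt_one ht.1.le ht.2 (by positivity)⟩, ?_⟩
      exact Real.rpow_inv_rpow ht.1.le ha.ne'
  have hinj : Set.InjOn (fun r : ℝ => r ^ a) (Set.Ioo 0 1) :=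
    (Real.strictMonoOn_rpow_Ici_of_exponent_pos ha).injOn.mono fun r hr => hr.1.le
  have := lintegral_image_eq_lintegral_abs_deriv_mul (f := fun r : ℝ => r ^ a)
    (f' := fun r => a * r ^ (a - 1)) measurableSet_Ioo
    (fun r hr => (Real.hasDerivAt_rpow_const (Or.inl hr.1.ne')).hasDerivWithinAt) hinj
    (fun t => ψ (t ^ a⁻¹))
  rw [himg] at this
  rw [this]
  refine setLIntegral_congr_fun measurableSet_Ioo fun r hr => ?_
  have h1 : 0 ≤ a * r ^ (a - 1) := mul_nonneg ha.le (Real.rpow_nonneg hr.1.le _)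
  simp only [abs_of_nonneg h1, Real.rpow_rpow_inv hr.1.le ha.ne']

/-- For fixed `t` in `(0,1)`, `t ^ a⁻¹ → 0` as `a → 0⁺`. After the substitution the measure no
longer depends on `a`, and dominated convergence applies. -/
lemma tendsto_lintegral_Ioo_comp_rpow_inv {ψ : ℝ → ℝ≥0∞} (hψ : Measurable ψ) {C L : ℝ≥0∞}
    (hC : C ≠ ⊤) (hb : ∀ r, 0 < r → ψ r ≤ C) (hL : Tendsto ψ (𝓝[>] 0) (𝓝 L)) :
    Tendsto (fun a : ℝ => ∫⁻ t in Set.Ioo (0 : ℝ) 1, ψ (t ^ a⁻¹)) (𝓝[>] 0) (𝓝 L) := by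
  have h1 : ∫⁻ _ in Set.Ioo (0 : ℝ) 1, L = L := by simp
  rw [← h1]
  refine tendsto_lintegral_filter_of_dominated_convergence (fun _ => C)
    (Eventually.of_forall fun a => by fun_prop) ?_ (by simpa using hC) ?_
  · refine Eventually.of_forall fun a => ?_
    filter_upwards [ae_restrict_mem measurableSet_Ioo] with t ht
    exact hb _ (Real.rpow_pos_of_pos ht.1 _)
  · filter_upwards [ae_restrict_mem measurableSet_Ioo] with t ht
    refine hL.comp (tendsto_nhdsWithin_iff.2 ⟨?_, ?_⟩)
    · exact (tendsto_rpow_atTop_of_base_lt_one t (by linarith [ht.1]) ht.2).comp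
        tendsto_inv_nhdsGT_zero
    · exact Eventually.of_forall fun a => Real.rpow_pos_of_pos ht.1 _

lemma lintegral_Ioi_one_rpow {b : ℝ} (hb : b < -1) :
    ∫⁻ r in Set.Ioi (1 : ℝ), ENNReal.ofReal (r ^ b) = ENNReal.ofReal (1 / (-b - 1)) := by
  rw [← ofReal_integral_eq_lintegral_ofReal (integrableOn_Ioi_rpow_of_lt hb zero_lt_one),
    integral_Ioi_rpow_of_lt hb zero_lt_one]
  · congr 1
    rw [Real.one_rpow, show -b - 1 = -(b + 1) by ring, div_neg, neg_div]
  · filter_upwards [ae_restrict_mem measurableSet_Ioi] with r hr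
    exact Real.rpow_nonneg (zero_le_one.trans (le_of_lt hr)) _

variable {p : ℝ} {Φ : ℝ → ℝ≥0∞}

/-- With `a = p(1-s)` one has `(1-s) r^{-1-sp} = (1/p) · a r^{a-1} · r^{-p}`; on the unit interval,
substitute `t = r^a`. -/
lemma ofReal_mul_lintegral_rpow_mul_eq (hp : 0 < p) {s : ℝ} (hs : s < 1) :
    ENNReal.ofReal (1 - s) * ∫⁻ r in Set.Ioi (0 : ℝ), ENNReal.ofReal (r ^ (-1 - s * p)) * Φ r =
      ENNReal.ofReal (1 / p) * (∫⁻ t in Set.Ioo (0 : ℝ) 1,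
        Φ (t ^ (p * (1 - s))⁻¹) / ENNReal.ofReal ((t ^ (p * (1 - s))⁻¹) ^ p)) +
      ENNReal.ofReal (1 - s) *
        ∫⁻ r in Set.Ioi (1 : ℝ), ENNReal.ofReal (r ^ (-1 - s * p)) * Φ r := by
  have ha : 0 < p * (1 - s) := mul_pos hp (by linarith)
  have hsplit : Set.Ioi (0 : ℝ) = Set.Ioc 0 1 ∪ Set.Ioi 1 :=
    (Set.Ioc_union_Ioi_eq_Ioi zero_le_one).symm
  rw [hsplit, lintegral_union measurableSet_Ioi
    (Set.Ioc_disjoint_Ioi (le_refl (1 : ℝ))), mul_add,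
    ← lintegral_Ioo_rpow_sub_one_mul ha (fun r => Φ r / ENNReal.ofReal (r ^ p)),
    ← setLIntegral_congr (Ioo_ae_eq_Ioc (μ := volume) (a := (0 : ℝ)) (b := 1)),
    ← lintegral_const_mul' _ _ ENNReal.ofReal_ne_top,
    ← lintegral_const_mul' (ENNReal.ofReal (1 / p)) _ ENNReal.ofReal_ne_top]
  congr 1
  refine setLIntegral_congr_fun measurableSet_Ioo fun r hr => ?_
  have hr0 : 0 < r := hr.1
  have hrp : 0 < r ^ p := Real.rpow_pos_of_pos hr0 _
  rw [div_eq_mul_inv (Φ r), ← ENNReal.ofReal_inv_of_pos hrp, mul_comm (Φ r), ← mul_assoc, ← mul_assoc,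
    ← mul_assoc, ← ENNReal.ofReal_mul (by linarith), ← ENNReal.ofReal_mul (by positivity),
    ← ENNReal.ofReal_mul (by positivity)]
  congr 2
  rw [← Real.rpow_neg hr0.le, mul_assoc, mul_assoc, ← Real.rpow_add hr0,
    show p * (1 - s) - 1 + -p = -1 - s * p by ring]
  field_simp

/-- The tail of the kernel integrates to `1/(sp)`; `s > 1/2` makes this at most `2/p`, independently
of `s`. -/
lemma ofReal_mul_lintegral_tail_le (hp : 0 < p) {M : ℝ≥0∞} (hM : ∀ r, Φ r ≤ M) {s : ℝ}
    (hs0 : 1 / 2 < s) (hMt : M ≠ ⊤) :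
    ENNReal.ofReal (1 - s) *
        ∫⁻ r in Set.Ioi (1 : ℝ), ENNReal.ofReal (r ^ (-1 - s * p)) * Φ r ≤
      ENNReal.ofReal (1 - s) * (ENNReal.ofReal (2 / p) * M) := by
  gcongr
  calc ∫⁻ r in Set.Ioi (1 : ℝ), ENNReal.ofReal (r ^ (-1 - s * p)) * Φ r
      ≤ ∫⁻ r in Set.Ioi (1 : ℝ), ENNReal.ofReal (r ^ (-1 - s * p)) * M := by
        gcongr with r; exact hM r
    _ = ENNReal.ofReal (1 / (s * p)) * M := by
        rw [lintegral_mul_const' _ _ hMt, lintegral_Ioi_one_rpow (by nlinarith)]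
        congr 3; ring
    _ ≤ ENNReal.ofReal (2 / p) * M := by
        refine mul_le_mul' (ENNReal.ofReal_le_ofReal ?_) le_rfl
        rw [div_le_div_iff₀ (by nlinarith) hp]
        nlinarith

/-- Supplies the majorant, uniform in `s` and in the direction, for dominated convergence over the
sphere. -/
lemma ofReal_mul_lintegral_rpow_mul_le (hp : 0 < p) {C M : ℝ≥0∞}
    (hC : ∀ r, 0 < r → Φ r / ENNReal.ofReal (r ^ p) ≤ C) (hM : ∀ r, Φ r ≤ M) (hMt : M ≠ ⊤)
    {s : ℝ} (hs0 : 1 / 2 < s) (hs : s < 1) :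
    ENNReal.ofReal (1 - s) * ∫⁻ r in Set.Ioi (0 : ℝ), ENNReal.ofReal (r ^ (-1 - s * p)) * Φ r ≤
      ENNReal.ofReal (1 / p) * C + ENNReal.ofReal (2 / p) * M := by
  rw [ofReal_mul_lintegral_rpow_mul_eq hp hs]
  refine add_le_add ?_ ((ofReal_mul_lintegral_tail_le hp hM hs0 hMt).trans ?_)
  · gcongr
    calc _ ≤ ∫⁻ _ in Set.Ioo (0 : ℝ) 1, C :=
          setLIntegral_mono measurable_const fun t ht => hC _ (Real.rpow_pos_of_pos ht.1 _)
      _ = C := by simp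
  · exact mul_le_of_le_one_left zero_le (by rw [ENNReal.ofReal_le_one]; linarith)

lemma tendsto_ofReal_mul_lintegral_rpow_mul (hp : 0 < p) (hΦ : Measurable Φ) {C M L : ℝ≥0∞}
    (hC : ∀ r, 0 < r → Φ r / ENNReal.ofReal (r ^ p) ≤ C) (hCt : C ≠ ⊤) (hM : ∀ r, Φ r ≤ M)
    (hMt : M ≠ ⊤) (hL : Tendsto (fun r => Φ r / ENNReal.ofReal (r ^ p)) (𝓝[>] 0) (𝓝 L)) :
    Tendsto (fun s : ℝ => ENNReal.ofReal (1 - s) *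
      ∫⁻ r in Set.Ioi (0 : ℝ), ENNReal.ofReal (r ^ (-1 - s * p)) * Φ r) (𝓝[<] 1)
      (𝓝 (ENNReal.ofReal (1 / p) * L)) := by
  have hone : Tendsto (fun s : ℝ => ENNReal.ofReal (1 - s)) (𝓝[<] 1) (𝓝 0) := by
    have : Continuous fun s : ℝ => ENNReal.ofReal (1 - s) :=
      ENNReal.continuous_ofReal.comp (by fun_prop)
    simpa using (this.tendsto 1).mono_left nhdsWithin_le_nhds
  have hmem : ∀ᶠ s : ℝ in 𝓝[<] 1, 1 / 2 < s ∧ s < 1 := by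
    filter_upwards [self_mem_nhdsWithin, mem_nhdsWithin_of_mem_nhds
      (Ioi_mem_nhds (show (1 / 2 : ℝ) < 1 by norm_num))] with s h1 h2
    exact ⟨h2, h1⟩
  have htail : Tendsto (fun s : ℝ => ENNReal.ofReal (1 - s) *
      ∫⁻ r in Set.Ioi (1 : ℝ), ENNReal.ofReal (r ^ (-1 - s * p)) * Φ r) (𝓝[<] 1) (𝓝 0) := by
    have hub : Tendsto (fun s : ℝ => ENNReal.ofReal (1 - s) * (ENNReal.ofReal (2 / p) * M))
        (𝓝[<] 1) (𝓝 0) := by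
      simpa using ENNReal.Tendsto.mul_const hone
        (Or.inr (ENNReal.mul_ne_top ENNReal.ofReal_ne_top hMt))
    refine tendsto_of_tendsto_of_tendsto_of_le_of_le' tendsto_const_nhds hub
      (Eventually.of_forall fun _ => zero_le) ?_
    filter_upwards [hmem] with s hs
    exact ofReal_mul_lintegral_tail_le hp hM hs.1 hMt
  have hexp : Tendsto (fun s : ℝ => p * (1 - s)) (𝓝[<] 1) (𝓝[>] 0) := by
    refine tendsto_nhdsWithin_iff.2 ⟨?_, ?_⟩
    · have : Continuous fun s : ℝ => p * (1 - s) := by fun_prop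
      simpa using (this.tendsto 1).mono_left nhdsWithin_le_nhds
    · filter_upwards [hmem] with s hs
      exact mul_pos hp (by linarith [hs.2])
  have hnear := (tendsto_lintegral_Ioo_comp_rpow_inv
    (ψ := fun r => Φ r / ENNReal.ofReal (r ^ p)) (by fun_prop) hCt hC hL).comp hexp
  have hsum := (ENNReal.Tendsto.const_mul (a := ENNReal.ofReal (1 / p)) hnear
    (Or.inr ENNReal.ofReal_ne_top)).add htail
  rw [add_zero] at hsum
  refine hsum.congr' ?_
  filter_upwards [hmem] with s hs
  rw [ofReal_mul_lintegral_rpow_mul_eq hp hs.2]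
  rfl

end RadialLimit

/-! ### Polar coordinates -/

section Polar

variable {E : Type*} [NormedAddCommGroup E] [NormedSpace ℝ E] [FiniteDimensional ℝ E]
  [MeasurableSpace E] [BorelSpace E] [Nontrivial E]

/-- Integration in polar coordinates. -/
lemma lintegral_eq_lintegral_toSphere (μ : Measure E) [μ.IsAddHaarMeasure] {F : E → ℝ≥0∞}
    (hF : Measurable F) :
    ∫⁻ z, F z ∂μ = ∫⁻ u : Metric.sphere (0 : E) 1, (∫⁻ r in Set.Ioi (0 : ℝ),
      ENNReal.ofReal (r ^ (Module.finrank ℝ E - 1)) * F (r • (u : E))) ∂μ.toSphere := by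
  have hmp := μ.measurePreserving_homeomorphUnitSphereProd
  have h1 : ∫⁻ z, F z ∂μ = ∫⁻ z : ({0}ᶜ : Set E), F z ∂(μ.comap (↑)) := by
    rw [lintegral_subtype_comap (measurableSet_singleton _).compl, restrict_compl_singleton]
  have h2 : ∀ z : ({0}ᶜ : Set E), F z =
      (fun q : Metric.sphere (0 : E) 1 × Set.Ioi (0 : ℝ) => F (q.2.1 • q.1.1))
        (homeomorphUnitSphereProd E z) := fun z => by
    have hz : ‖(z : E)‖ ≠ 0 := norm_ne_zero_iff.2 z.2
    simp [smul_smul, hz]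
  have hm : Measurable (fun q : Metric.sphere (0 : E) 1 × Set.Ioi (0 : ℝ) =>
      F (q.2.1 • q.1.1)) := by fun_prop
  rw [h1]
  simp_rw [h2]
  rw [hmp.lintegral_comp hm, lintegral_prod _ hm.aemeasurable]
  congr 1 with u
  rw [Measure.volumeIoiPow, lintegral_withDensity_eq_lintegral_mul _ (by fun_prop) (by fun_prop)]
  simp only [Pi.mul_apply]
  rw [← lintegral_subtype_comap measurableSet_Ioi]
end Polar

/-! ### The gauge of the polar moment body -/

section MomentBody

variable {n : ℕ} {p : ℝ} {K : Set (EuclideanSpace ℝ (Fin n))}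

lemma momentIntegral_nonneg (hp : 0 ≤ p) (v : EuclideanSpace ℝ (Fin n)) :
    0 ≤ momentIntegral p K v :=
  mul_nonneg (by positivity)
    (integral_nonneg fun x => Real.rpow_nonneg (le_max_left _ _) _)

lemma momentIntegral_smul {c : ℝ} (hc : 0 ≤ c) (v : EuclideanSpace ℝ (Fin n)) :
    momentIntegral p K (c • v) = c ^ p * momentIntegral p K v := by
  unfold momentIntegral
  rw [mul_left_comm, ← integral_const_mul (c ^ p)]
  congr 1
  refine integral_congr_ae (Eventually.of_forall fun x => ?_)
  simp only []
  rw [← Real.mul_rpow hc (le_max_left _ _), mul_max_of_nonneg _ _ hc, mul_zero,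
    real_inner_smul_left]

/-- A nonnegative function that is positively homogeneous of degree one is the gauge of its unit
sublevel set; convexity plays no role. -/
lemma gauge_polarMomentBody (hp : 0 < p) (v : EuclideanSpace ℝ (Fin n)) :
    gauge (polarMomentBody p K) v = momentIntegral p K v ^ (1 / p) := by
  set m := momentIntegral p K v with hm
  have hm0 : 0 ≤ m := momentIntegral_nonneg hp.le v
  have hset : {r ∈ Set.Ioi (0 : ℝ) | r⁻¹ • v ∈ polarMomentBody p K} =
      {r ∈ Set.Ioi (0 : ℝ) | m ^ (1 / p) ≤ r} := by
    ext r
    refine and_congr_right fun hr => ?_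
    have hr : 0 < r := hr
    simp only [polarMomentBody, Set.mem_ofPred_eq]
    rw [momentIntegral_smul (inv_nonneg.2 hr.le), Real.mul_rpow (by positivity) hm0,
      ← Real.rpow_mul (by positivity), mul_one_div_cancel hp.ne', Real.rpow_one,
      inv_mul_le_iff₀ hr, mul_one]
  rw [gauge_def', hset]
  rcases (Real.rpow_nonneg hm0 (1 / p)).eq_or_lt with h | h
  -- When the moment vanishes, the admissible radii form an open half-line, whose infimum is still
  -- `0`.
  · rw [← h]
    have : {r ∈ Set.Ioi (0 : ℝ) | 0 ≤ r} = Set.Ioi 0 := by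
      ext r
      exact ⟨fun h => h.1, fun h => ⟨h, le_of_lt h⟩⟩
    rw [this, csInf_Ioi]
  · have : {r ∈ Set.Ioi (0 : ℝ) | m ^ (1 / p) ≤ r} = Set.Ici (m ^ (1 / p)) := by
      ext r
      exact ⟨fun h => h.2, fun h' => ⟨h.trans_le h', h'⟩⟩
    rw [this, csInf_Ici]

lemma gauge_polarMomentBody_rpow (hp : 0 < p) (v : EuclideanSpace ℝ (Fin n)) :
    gauge (polarMomentBody p K) v ^ p = momentIntegral p K v := by
  rw [gauge_polarMomentBody hp, one_div, Real.rpow_inv_rpow (momentIntegral_nonneg hp.le v) hp.ne']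

end MomentBody

/-! ### Bounds for the gauge of a convex body -/

section ConvexBodyGauge

variable {E : Type*} [NormedAddCommGroup E] [NormedSpace ℝ E] {K : ConvexBody E}

lemma ConvexBody.continuous_gauge (hK : (0 : E) ∈ interior (K : Set E)) :
    Continuous (gauge (K : Set E)) :=
  _root_.continuous_gauge K.convex (mem_interior_iff_mem_nhds.1 hK)

lemma ConvexBody.gauge_pos (hK : (0 : E) ∈ interior (K : Set E)) {x : E} (hx : x ≠ 0) :
    0 < gauge (K : Set E) x :=
  (_root_.gauge_pos (absorbent_nhds_zero (mem_interior_iff_mem_nhds.1 hK))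
    (NormedSpace.isVonNBounded_of_isBounded ℝ K.isBounded)).2 hx

lemma ConvexBody.mem_iff_gauge_le_one (hK : (0 : E) ∈ interior (K : Set E)) {x : E} :
    x ∈ (K : Set E) ↔ gauge (K : Set E) x ≤ 1 := by
  rw [gauge_le_one_iff_mem_closure K.convex (mem_interior_iff_mem_nhds.1 hK),
    K.isClosed.closure_eq]

/-- The continuous positive gauge attains its minimum on the compact sphere. Capping `c` at `1`
makes powers of `c` monotone in the exponent, as the next bound requires. -/
lemma ConvexBody.exists_le_gauge_sphere [FiniteDimensional ℝ E]
    (hK : (0 : E) ∈ interior (K : Set E)) :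
    ∃ c, 0 < c ∧ c ≤ 1 ∧ ∀ u ∈ Metric.sphere (0 : E) 1, c ≤ gauge (K : Set E) u := by
  have : ProperSpace E := FiniteDimensional.proper ℝ E
  rcases (Metric.sphere (0 : E) 1).eq_empty_or_nonempty with h | h
  · exact ⟨1, one_pos, le_rfl, by simp [h]⟩
  · obtain ⟨u, hu, hmin⟩ := (isCompact_sphere (0 : E) 1).exists_isMinOn h
      (ConvexBody.continuous_gauge hK).continuousOn
    have hu0 : u ≠ 0 := by rintro rfl; simp at hu
    exact ⟨min (gauge (K : Set E) u) 1, lt_min (ConvexBody.gauge_pos hK hu0) one_pos,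
      min_le_right _ _, fun w hw => (min_le_left _ _).trans (hmin hw)⟩

open Module in
lemma ConvexBody.exists_gauge_rpow_neg_le [FiniteDimensional ℝ E] (hK : (0 : E) ∈ interior (K : Set E)) {p : ℝ} (hp : 0 ≤ p) :
    ∃ B : ℝ, ∀ u ∈ Metric.sphere (0 : E) 1, ∀ s ∈ Set.Icc (0 : ℝ) 1,
      gauge (K : Set E) u ^ (-(finrank ℝ E + s * p)) ≤ B := by
  obtain ⟨c, hc, hc1, hcu⟩ := ConvexBody.exists_le_gauge_sphere hK
  refine ⟨c ^ (-(finrank ℝ E + p)), fun u hu s hs => ?_⟩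
  have h1 : 0 ≤ finrank ℝ E + s * p := add_nonneg (by positivity) (mul_nonneg hs.1 hp)
  refine (Real.rpow_le_rpow_of_nonpos hc (hcu u hu) (by linarith)).trans ?_
  refine Real.rpow_le_rpow_of_exponent_ge hc hc1 ?_
  nlinarith [hs.2]

end ConvexBodyGauge

/-! ### Both energies as spherical integrals, and the limit -/

lemma lintegral_Ioc_zero_rpow_sub_one {q c : ℝ} (hq : 0 < q) (hc : 0 ≤ c) :
    ∫⁻ r in Set.Ioc (0 : ℝ) c, ENNReal.ofReal (r ^ (q - 1)) = ENNReal.ofReal (c ^ q / q) := by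
  have hi : IntervalIntegrable (fun r : ℝ => r ^ (q - 1)) volume 0 c :=
    intervalIntegral.intervalIntegrable_rpow' (by linarith)
  rw [intervalIntegrable_iff_integrableOn_Ioc_of_le hc] at hi
  rw [← ofReal_integral_eq_lintegral_ofReal hi, ← intervalIntegral.integral_of_le hc,
    integral_rpow (Or.inl (by linarith))]
  · simp [Real.zero_rpow hq.ne']
  · filter_upwards [ae_restrict_mem measurableSet_Ioc] with r hr
    exact Real.rpow_nonneg hr.1.le _

section Energy

variable {E : Type*} [NormedAddCommGroup E] [InnerProductSpace ℝ E] [FiniteDimensional ℝ E]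
  [MeasurableSpace E] [BorelSpace E] [Nontrivial E] {K : ConvexBody E} {p : ℝ}

open Module in
/-- The moment integral of a convex body as an integral over the sphere. -/
lemma ofReal_mul_setIntegral_posPart_inner (hK : (0 : E) ∈ interior (K : Set E)) (hp : 0 < p)
    (v : E) :
    ENNReal.ofReal ((finrank ℝ E + p) * ∫ x in (K : Set E), max 0 (inner ℝ v x) ^ p) =
      ∫⁻ u : Metric.sphere (0 : E) 1,
        ENNReal.ofReal (gauge (K : Set E) (u : E) ^ (-(finrank ℝ E + p))) *
          ENNReal.ofReal (max 0 (inner ℝ v (u : E)) ^ p) ∂(volume : Measure E).toSphere := by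
  have hN : 1 ≤ finrank ℝ E := finrank_pos
  have hq : 0 < (finrank ℝ E : ℝ) + p := by positivity
  have hcont : Continuous fun x : E => max 0 (inner ℝ v x) ^ p :=
    (continuous_const.max (by fun_prop)).rpow_const fun _ => Or.inr hp.le
  have hKm : MeasurableSet (K : Set E) := K.isClosed.measurableSet
  rw [ENNReal.ofReal_mul hq.le, ofReal_integral_eq_lintegral_ofReal
    (hcont.continuousOn.integrableOn_compact K.isCompact)
    (Eventually.of_forall fun x => Real.rpow_nonneg (le_max_left _ _) _),
    ← lintegral_indicator hKm, lintegral_eq_lintegral_toSphere _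
    ((by fun_prop : Measurable fun x : E => ENNReal.ofReal (max 0 (inner ℝ v x) ^ p)).indicator
      hKm), ← lintegral_const_mul' _ _ ENNReal.ofReal_ne_top]
  congr 1 with u
  have hu0 : (u : E) ≠ 0 := by
    intro h
    have := u.2
    simp [h] at this
  have hκ : 0 < gauge (K : Set E) (u : E) := ConvexBody.gauge_pos hK hu0
  set κ := gauge (K : Set E) (u : E) with hκd
  -- The ray through `u` meets `K` in `r ≤ 1/κ`. There `r^{N-1} r^p` integrates to
  -- `κ^{-(N+p)}/(N+p)`, with `N` the dimension, which cancels the prefactor.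
  have hinner : ∫⁻ r in Set.Ioi (0 : ℝ), ENNReal.ofReal (r ^ (finrank ℝ E - 1)) *
      (K : Set E).indicator (fun x => ENNReal.ofReal (max 0 (inner ℝ v x) ^ p)) (r • (u : E)) =
      ∫⁻ r in Set.Ioc (0 : ℝ) κ⁻¹, ENNReal.ofReal (r ^ ((finrank ℝ E : ℝ) + p - 1)) *
        ENNReal.ofReal (max 0 (inner ℝ v (u : E)) ^ p) := by
    rw [← lintegral_indicator measurableSet_Ioi, ← lintegral_indicator measurableSet_Ioc]
    congr 1 with r
    by_cases hr : 0 < r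
    · have hmem : r • (u : E) ∈ (K : Set E) ↔ r ∈ Set.Ioc 0 κ⁻¹ := by
        rw [ConvexBody.mem_iff_gauge_le_one hK, gauge_smul_of_nonneg hr.le, Set.mem_Ioc,
          le_inv_comm₀ hr hκ, smul_eq_mul, ← hκd, inv_eq_one_div, le_div_iff₀ hr, mul_comm]
        simp [hr]
      rw [Set.indicator_of_mem (Set.mem_Ioi.2 hr)]
      by_cases hk : r ∈ Set.Ioc 0 κ⁻¹
      · rw [Set.indicator_of_mem hk, Set.indicator_of_mem (hmem.2 hk), real_inner_smul_right,
          ← ENNReal.ofReal_mul (by positivity), ← ENNReal.ofReal_mul (by positivity)]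
        congr 1
        rw [← mul_zero r, ← mul_max_of_nonneg _ _ hr.le, mul_zero,
          Real.mul_rpow hr.le (le_max_left _ _), ← mul_assoc, ← Real.rpow_natCast,
          ← Real.rpow_add hr, Nat.cast_sub hN, Nat.cast_one]
        congr 2
        ring
      · rw [Set.indicator_of_notMem hk, Set.indicator_of_notMem (fun h => hk (hmem.1 h)), mul_zero]
    · rw [Set.indicator_of_notMem (by simpa using hr),
        Set.indicator_of_notMem (fun h => hr h.1)]
  rw [hinner, lintegral_mul_const' _ _ ENNReal.ofReal_ne_top,
    lintegral_Ioc_zero_rpow_sub_one hq (inv_nonneg.2 hκ.le), ← mul_assoc,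
    ← ENNReal.ofReal_mul hq.le, Real.inv_rpow hκ.le, ← Real.rpow_neg hκ.le,
    mul_div_cancel₀ _ hq.ne']

variable {f : E → ℝ} {g : E → E}

open Module in
/-- The fractional energy in polar coordinates. -/
lemma lintegral_fracEnergy_eq (hK : (0 : E) ∈ interior (K : Set E)) (hfm : Measurable f) (s : ℝ) :
    ∫⁻ y, ∫⁻ x, ENNReal.ofReal
        (max 0 (f x - f y) ^ p / gauge (K : Set E) (x - y) ^ (finrank ℝ E + s * p)) =
      ∫⁻ u : Metric.sphere (0 : E) 1,
        ENNReal.ofReal (gauge (K : Set E) (u : E) ^ (-(finrank ℝ E + s * p))) *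
          (∫⁻ r in Set.Ioi (0 : ℝ), ENNReal.ofReal (r ^ (-1 - s * p)) *
            ∫⁻ y, ENNReal.ofReal (max 0 (f (y + r • (u : E)) - f y) ^ p))
        ∂(volume : Measure E).toSphere := by
  have hN : 1 ≤ finrank ℝ E := finrank_pos
  have hκm : Measurable (gauge (K : Set E)) := (ConvexBody.continuous_gauge hK).measurable
  have hΦ := measurable_lintegral_posPart_increment (p := p) hfm
  calc ∫⁻ y, ∫⁻ x, ENNReal.ofReal
        (max 0 (f x - f y) ^ p / gauge (K : Set E) (x - y) ^ (finrank ℝ E + s * p))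
      = ∫⁻ y, ∫⁻ z, ENNReal.ofReal
          (max 0 (f (y + z) - f y) ^ p / gauge (K : Set E) z ^ (finrank ℝ E + s * p)) := by
        congr 1 with y
        rw [← lintegral_add_left_eq_self _ y]
        simp
    _ = ∫⁻ z, ∫⁻ y, ENNReal.ofReal
          (max 0 (f (y + z) - f y) ^ p / gauge (K : Set E) z ^ (finrank ℝ E + s * p)) :=
        lintegral_lintegral_swap (by fun_prop)
    _ = ∫⁻ z, ENNReal.ofReal (gauge (K : Set E) z ^ (-(finrank ℝ E + s * p))) *
          ∫⁻ y, ENNReal.ofReal (max 0 (f (y + z) - f y) ^ p) := by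
        congr 1 with z
        rw [← lintegral_const_mul' _ _ ENNReal.ofReal_ne_top]
        congr 1 with y
        rw [← ENNReal.ofReal_mul (Real.rpow_nonneg (gauge_nonneg _) _),
          Real.rpow_neg (gauge_nonneg _), div_eq_inv_mul]
    _ = _ := by
        rw [lintegral_eq_lintegral_toSphere _ (by fun_prop)]
        congr 1 with u
        rw [← lintegral_const_mul' _ _ ENNReal.ofReal_ne_top]
        -- The Jacobian and the homogeneous kernel combine as `r^{N-1} r^{-(N+sp)} = r^{-1-sp}`.
        refine setLIntegral_congr_fun measurableSet_Ioi fun r hr => ?_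
        have hr : 0 < r := hr
        rw [← mul_assoc, ← mul_assoc, gauge_smul_of_nonneg hr.le, smul_eq_mul,
          Real.mul_rpow hr.le (gauge_nonneg _), ← ENNReal.ofReal_mul (by positivity),
          ← ENNReal.ofReal_mul (Real.rpow_nonneg (gauge_nonneg _) _), ← mul_assoc,
          ← Real.rpow_natCast, ← Real.rpow_add hr, mul_comm, Nat.cast_sub hN, Nat.cast_one,
          mul_comm (r ^ _), show (finrank ℝ E : ℝ) - 1 + -(finrank ℝ E + s * p) = -1 - s * p by ring,
          mul_comm]

open Module in
lemma lintegral_ofReal_moment_eq (hK : (0 : E) ∈ interior (K : Set E)) (hp : 0 < p)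
    (hgm : Measurable g) :
    ∫⁻ x, ENNReal.ofReal ((finrank ℝ E + p) *
        ∫ y in (K : Set E), max 0 (inner ℝ (g x) y) ^ p) =
      ∫⁻ u : Metric.sphere (0 : E) 1,
        ENNReal.ofReal (gauge (K : Set E) (u : E) ^ (-(finrank ℝ E + p))) *
          (∫⁻ x, ENNReal.ofReal (max 0 (inner ℝ (g x) (u : E)) ^ p))
        ∂(volume : Measure E).toSphere := by
  have hκm : Measurable (gauge (K : Set E)) := (ConvexBody.continuous_gauge hK).measurable
  simp_rw [ofReal_mul_setIntegral_posPart_inner hK hp]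
  rw [lintegral_lintegral_swap (by fun_prop)]
  congr 1 with u
  rw [lintegral_const_mul' _ _ ENNReal.ofReal_ne_top]

open Module in
lemma lintegral_ofReal_moment_lt_top (hK : (0 : E) ∈ interior (K : Set E)) (hp : 1 ≤ p)
    (hgm : Measurable g) (hgp : MemLp g (ENNReal.ofReal p) volume) :
    ∫⁻ x, ENNReal.ofReal ((finrank ℝ E + p) *
        ∫ y in (K : Set E), max 0 (inner ℝ (g x) y) ^ p) < ⊤ := by
  have h0 : 0 < p := zero_lt_one.trans_le hp
  obtain ⟨B, hB⟩ := ConvexBody.exists_gauge_rpow_neg_le hK h0.le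
  rw [lintegral_ofReal_moment_eq hK h0 hgm]
  calc _ ≤ ∫⁻ _ : Metric.sphere (0 : E) 1, (ENNReal.ofReal B * ∫⁻ y, ‖g y‖ₑ ^ p)
        ∂(volume : Measure E).toSphere := by
        refine lintegral_mono fun u => mul_le_mul' (ENNReal.ofReal_le_ofReal ?_) ?_
        · simpa using hB u u.2 1 (by simp)
        · refine (lintegral_posPart_inner_le h0.le hgm _).trans ?_
          have : ‖(u : E)‖ₑ = 1 := by
            rw [← ofReal_norm, norm_eq_of_mem_sphere, ENNReal.ofReal_one]
          simp [this]
    _ < ⊤ := by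
        rw [lintegral_const]
        exact ENNReal.mul_lt_top (ENNReal.mul_lt_top ENNReal.ofReal_lt_top
          (lintegral_enorm_rpow_lt_top hp hgp)) (measure_lt_top _ _)

open Module in
lemma tendsto_fracEnergy (hK : (0 : E) ∈ interior (K : Set E)) (hp : 1 ≤ p)
    (hfm : Measurable f) (hfp : MemLp f (ENNReal.ofReal p) volume)
    (hgm : Measurable g) (hg : LocallyIntegrable g volume)
    (hgp : MemLp g (ENNReal.ofReal p) volume)
    (hinc : ∀ z : E, ∀ᵐ y,
      f (y + z) - f y = ∫ t in Set.Ioc (0 : ℝ) 1, inner ℝ (g (y + t • z)) z) :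
    Tendsto (fun s : ℝ => ENNReal.ofReal (1 - s) * ∫⁻ y, ∫⁻ x, ENNReal.ofReal
        (max 0 (f x - f y) ^ p / gauge (K : Set E) (x - y) ^ (finrank ℝ E + s * p)))
      (𝓝[<] 1)
      (𝓝 (ENNReal.ofReal (1 / p) * ∫⁻ x, ENNReal.ofReal ((finrank ℝ E + p) *
        ∫ y in (K : Set E), max 0 (inner ℝ (g x) y) ^ p))) := by
  have h0 : 0 < p := zero_lt_one.trans_le hp
  obtain ⟨B, hB⟩ := ConvexBody.exists_gauge_rpow_neg_le hK h0.le
  have hκm : Measurable (gauge (K : Set E)) := (ConvexBody.continuous_gauge hK).measurable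
  have hΦm := measurable_lintegral_posPart_increment (p := p) hfm
  have hCt : ∫⁻ y, ‖g y‖ₑ ^ p ≠ ⊤ := (lintegral_enorm_rpow_lt_top hp hgp).ne
  have hft : ∫⁻ y, ‖f y‖ₑ ^ p ≠ ⊤ := (lintegral_enorm_rpow_lt_top hp hfp).ne
  set Φ : E → ℝ≥0∞ := fun z => ∫⁻ y, ENNReal.ofReal (max 0 (f (y + z) - f y) ^ p) with hΦd
  set C := ∫⁻ y, ‖g y‖ₑ ^ p with hCd
  set M : ℝ≥0∞ := 2 ^ (p - 1) * ((∫⁻ y, ‖f y‖ₑ ^ p) + ∫⁻ y, ‖f y‖ₑ ^ p) with hMd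
  have hMt : M ≠ ⊤ := by
    have : (2 : ℝ≥0∞) ^ (p - 1) ≠ ⊤ := ENNReal.rpow_ne_top_of_nonneg (by linarith) (by simp)
    exact ENNReal.mul_ne_top this (ENNReal.add_ne_top.2 ⟨hft, hft⟩)
  have hΦM : ∀ z, Φ z ≤ M := fun z => lintegral_posPart_increment_le hp hfm z
  have hnorm : ∀ u : Metric.sphere (0 : E) 1, ‖(u : E)‖ₑ = 1 := fun u => by
    rw [← ofReal_norm, norm_eq_of_mem_sphere, ENNReal.ofReal_one]
  have hΦC : ∀ u : Metric.sphere (0 : E) 1, ∀ r : ℝ, 0 < r →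
      Φ (r • (u : E)) / ENNReal.ofReal (r ^ p) ≤ C := by
    intro u r hr
    refine ENNReal.div_le_of_le_mul ?_
    calc Φ (r • (u : E)) ≤ ∫⁻ y, ‖f (y + r • (u : E)) - f y‖ₑ ^ p :=
          lintegral_mono fun y => ofReal_max_zero_rpow_le h0.le _
      _ ≤ ‖r • (u : E)‖ₑ ^ p * C := lintegral_enorm_translate_sub_rpow_le hp hgm (hinc _)
      _ = C * ENNReal.ofReal (r ^ p) := by
          rw [enorm_smul, hnorm, mul_one, Real.enorm_of_nonneg hr.le,
            ENNReal.ofReal_rpow_of_nonneg hr.le h0.le, mul_comm]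
  have hmem : ∀ᶠ s : ℝ in 𝓝[<] 1, 1 / 2 < s ∧ s < 1 := by
    filter_upwards [self_mem_nhdsWithin, mem_nhdsWithin_of_mem_nhds
      (Ioi_mem_nhds (show (1 / 2 : ℝ) < 1 by norm_num))] with s h1 h2
    exact ⟨h2, h1⟩
  set A : ℝ → Metric.sphere (0 : E) 1 → ℝ≥0∞ := fun s u => ENNReal.ofReal (1 - s) *
    ∫⁻ r in Set.Ioi (0 : ℝ), ENNReal.ofReal (r ^ (-1 - s * p)) * Φ (r • (u : E)) with hA
  set W : ℝ → Metric.sphere (0 : E) 1 → ℝ≥0∞ := fun s u =>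
    ENNReal.ofReal (gauge (K : Set E) (u : E) ^ (-(finrank ℝ E + s * p))) with hW
  have hAm : ∀ s, Measurable (A s) := fun s =>
    (Measurable.lintegral_prod_right' (f := fun q : Metric.sphere (0 : E) 1 × ℝ =>
      ENNReal.ofReal (q.2 ^ (-1 - s * p)) * Φ (q.2 • (q.1 : E))) (by fun_prop)).const_mul _
  have hWm : ∀ s, Measurable (W s) := fun s => by fun_prop
  -- Dominated convergence over the sphere: the weights are bounded by `B`, the radial factors by a
  -- constant built from `C` and `M`, and the sphere has finite measure.
  have hlim : Tendsto (fun s => ∫⁻ u, W s u * A s u ∂(volume : Measure E).toSphere) (𝓝[<] 1)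
      (𝓝 (∫⁻ u : Metric.sphere (0 : E) 1, W 1 u * (ENNReal.ofReal (1 / p) *
        ∫⁻ x, ENNReal.ofReal (max 0 (inner ℝ (g x) (u : E)) ^ p))
        ∂(volume : Measure E).toSphere)) := by
    refine tendsto_lintegral_filter_of_dominated_convergence
      (fun _ => ENNReal.ofReal B * (ENNReal.ofReal (1 / p) * C + ENNReal.ofReal (2 / p) * M))
      (Eventually.of_forall fun s => (hWm s).mul (hAm s)) ?_ ?_ ?_
    · filter_upwards [hmem] with s hs
      refine Eventually.of_forall fun u => mul_le_mul' ?_ ?_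
      · exact ENNReal.ofReal_le_ofReal (hB u u.2 s ⟨by linarith [hs.1], hs.2.le⟩)
      · exact ofReal_mul_lintegral_rpow_mul_le h0 (hΦC u) (fun r => hΦM _) hMt
          hs.1 hs.2
    · rw [lintegral_const]
      finiteness
    · refine Eventually.of_forall fun u => ?_
      have hu0 : (u : E) ≠ 0 := by
        intro h
        have := u.2
        simp [h] at this
      have hκ : 0 < gauge (K : Set E) (u : E) := ConvexBody.gauge_pos hK hu0
      refine ENNReal.Tendsto.mul ?_ (Or.inr ?_) ?_ (Or.inr ENNReal.ofReal_ne_top)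
      · have hcW : Continuous fun s : ℝ =>
            gauge (K : Set E) (u : E) ^ (-(finrank ℝ E + s * p)) :=
          continuous_const.rpow (by fun_prop) fun _ => Or.inl hκ.ne'
        exact ((ENNReal.continuous_ofReal.comp hcW).tendsto 1).mono_left nhdsWithin_le_nhds
      · refine ENNReal.mul_ne_top ENNReal.ofReal_ne_top (ne_top_of_le_ne_top ?_
          (lintegral_posPart_inner_le h0.le hgm (u : E)))
        rw [hnorm]
        simpa using hCt
      · exact tendsto_ofReal_mul_lintegral_rpow_mul h0 (by fun_prop) (hΦC u) hCt
          (fun r => hΦM _) hMt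
          (tendsto_lintegral_posPart_differenceQuotient hp hfm hgm hg hgp hinc (u : E))
  have hfinal : ENNReal.ofReal (1 / p) * ∫⁻ x, ENNReal.ofReal ((finrank ℝ E + p) *
        ∫ y in (K : Set E), max 0 (inner ℝ (g x) y) ^ p) =
      ∫⁻ u : Metric.sphere (0 : E) 1, W 1 u * (ENNReal.ofReal (1 / p) *
        ∫⁻ x, ENNReal.ofReal (max 0 (inner ℝ (g x) (u : E)) ^ p))
        ∂(volume : Measure E).toSphere := by
    rw [lintegral_ofReal_moment_eq hK h0 hgm, ← lintegral_const_mul' _ _ ENNReal.ofReal_ne_top]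
    congr 1 with u
    rw [hW, mul_left_comm]
    simp
  rw [hfinal]
  refine hlim.congr fun s => ?_
  rw [lintegral_fracEnergy_eq hK hfm s, ← lintegral_const_mul' _ _ ENNReal.ofReal_ne_top]
  congr 1 with u
  exact mul_left_comm _ _ _

end Energy

/-! ### Uniqueness and linearity of weak gradients -/

section WeakGradient

variable {n : ℕ} {f f' : EuclideanSpace ℝ (Fin n) → ℝ}
  {g g' : EuclideanSpace ℝ (Fin n) → EuclideanSpace ℝ (Fin n)}

lemma HasWeakGradient.congr_ae (h : HasWeakGradient f g) (hf : f =ᵐ[volume] f')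
    (hg : g =ᵐ[volume] g') : HasWeakGradient f' g' where
  locallyIntegrable := h.locallyIntegrable.congr hf
  locallyIntegrable_grad := h.locallyIntegrable_grad.congr hg
  integral_eq φ hφ hc i := by
    have h1 : ∫ x, f x * fderiv ℝ φ x (EuclideanSpace.single i 1) =
        ∫ x, f' x * fderiv ℝ φ x (EuclideanSpace.single i 1) :=
      integral_congr_ae (hf.mono fun x hx => by simp only [hx])
    have h2 : ∫ x, g x i * φ x = ∫ x, g' x i * φ x :=
      integral_congr_ae (hg.mono fun x hx => by simp only [hx])
    rw [← h1, ← h2, h.integral_eq φ hφ hc i]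

/-- The fundamental lemma of the calculus of variations, applied in each coordinate. It lets any
weak gradient inherit the `L^p` bound known for one of them. -/
lemma HasWeakGradient.ae_eq (h : HasWeakGradient f g) (h' : HasWeakGradient f g') :
    g =ᵐ[volume] g' := by
  have hloc : ∀ {k : EuclideanSpace ℝ (Fin n) → EuclideanSpace ℝ (Fin n)},
      LocallyIntegrable k volume → ∀ i, LocallyIntegrable (fun x => k x i) volume := by
    intro k hk i
    rw [locallyIntegrable_iff] at hk ⊢
    intro C hC
    exact (EuclideanSpace.proj (𝕜 := ℝ) i).integrable_comp (hk C hC)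
  have hi : ∀ i, ∀ᵐ x, g x i = g' x i := fun i =>
    ae_eq_of_integral_contDiff_smul_eq (hloc h.locallyIntegrable_grad i)
      (hloc h'.locallyIntegrable_grad i) fun φ hφ hc => by
        have := (h.integral_eq φ hφ hc i).symm.trans (h'.integral_eq φ hφ hc i)
        simpa [mul_comm] using this
  filter_upwards [ae_all_iff.2 hi] with x hx
  ext i
  exact hx i

lemma HasWeakGradient.integral_fderiv_apply (h : HasWeakGradient f g)
    {φ : EuclideanSpace ℝ (Fin n) → ℝ} (hφ : ContDiff ℝ ∞ φ) (hc : HasCompactSupport φ)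
    (z : EuclideanSpace ℝ (Fin n)) :
    ∫ x, f x * fderiv ℝ φ x z = - ∫ x, inner ℝ (g x) z * φ x := by
  have hz : z = ∑ i, z i • EuclideanSpace.single i (1 : ℝ) := by
    simpa using ((EuclideanSpace.basisFun (Fin n) ℝ).sum_repr z).symm
  have h1 : ∀ i, Integrable (fun x => z i * (f x * fderiv ℝ φ x (EuclideanSpace.single i 1)))
      volume := fun i => by
    refine Integrable.const_mul ?_ _
    simpa [mul_comm] using h.locallyIntegrable.integrable_smul_left_of_hasCompactSupport
      ((hφ.continuous_fderiv (by simp)).clm_apply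
        (continuous_const (y := EuclideanSpace.single i (1 : ℝ))))
      (hc.fderiv_apply (𝕜 := ℝ) (EuclideanSpace.single i (1 : ℝ)))
  have h2 : ∀ i, Integrable (fun x => z i * (g x i * φ x)) volume := fun i => by
    refine Integrable.const_mul ?_ _
    have := (EuclideanSpace.proj (𝕜 := ℝ) i).integrable_comp
      (h.locallyIntegrable_grad.integrable_smul_left_of_hasCompactSupport hφ.continuous hc)
    simpa [mul_comm] using this
  calc ∫ x, f x * fderiv ℝ φ x z
      = ∫ x, ∑ i, z i * (f x * fderiv ℝ φ x (EuclideanSpace.single i 1)) := by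
        congr 1 with x
        conv_lhs => rw [hz, map_sum, Finset.mul_sum]
        refine Finset.sum_congr rfl fun i _ => ?_
        rw [map_smul, smul_eq_mul]; ring
    _ = ∑ i, z i * -∫ x, g x i * φ x := by
        rw [integral_finsetSum _ fun i _ => h1 i]
        refine Finset.sum_congr rfl fun i _ => ?_
        rw [integral_const_mul, h.integral_eq φ hφ hc i]
    _ = - ∫ x, ∑ i, z i * (g x i * φ x) := by
        rw [integral_finsetSum _ fun i _ => h2 i, ← Finset.sum_neg_distrib]
        refine Finset.sum_congr rfl fun i _ => ?_
        rw [integral_const_mul, mul_neg]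
    _ = - ∫ x, inner ℝ (g x) z * φ x := by
        congr 2 with x
        rw [PiLp.inner_apply, Finset.sum_mul]
        refine Finset.sum_congr rfl fun i _ => ?_
        simp [mul_assoc]

end WeakGradient

/-! ### Passage to measurable representatives and conclusion -/

section Reduction

variable {n : ℕ} {p : ℝ} {K L : Set (EuclideanSpace ℝ (Fin n))}

lemma asymFracEnergy_congr_ae {f f' : EuclideanSpace ℝ (Fin n) → ℝ} (h : f =ᵐ[volume] f')
    (s : ℝ) : asymFracEnergy p s K f = asymFracEnergy p s K f' := by
  unfold asymFracEnergy
  refine lintegral_congr_ae (h.mono fun y hy => ?_)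
  refine lintegral_congr_ae (h.mono fun x hx => ?_)
  simp only [hx, hy]

lemma anisoEnergy_congr_ae {g g' : EuclideanSpace ℝ (Fin n) → EuclideanSpace ℝ (Fin n)}
    (h : g =ᵐ[volume] g') : anisoEnergy p L g = anisoEnergy p L g' :=
  lintegral_congr_ae (h.mono fun x hx => by simp only [hx])

lemma anisoEnergy_polarMomentBody (hp : 0 < p)
    (g : EuclideanSpace ℝ (Fin n) → EuclideanSpace ℝ (Fin n)) :
    anisoEnergy p (polarMomentBody p K) g =
      ∫⁻ x, ENNReal.ofReal ((n + p) * ∫ y in K, max 0 (inner ℝ (g x) y) ^ p) := by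
  unfold anisoEnergy
  simp_rw [gauge_polarMomentBody_rpow hp]
  rfl

end Reduction

theorem theorem1 {n : ℕ} (p : ℝ) (hp : 1 ≤ p)
    (K : ConvexBody (EuclideanSpace ℝ (Fin n)))
    (hK : (0 : EuclideanSpace ℝ (Fin n)) ∈ interior (K : Set (EuclideanSpace ℝ (Fin n))))
    (f : EuclideanSpace ℝ (Fin n) → ℝ) (hf : MemW1p p f) (hsupp : HasCompactEssSupport f)
    (g : EuclideanSpace ℝ (Fin n) → EuclideanSpace ℝ (Fin n)) (hg : HasWeakGradient f g) :
    (∀ v : EuclideanSpace ℝ (Fin n),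
      gauge (polarMomentBody p (K : Set (EuclideanSpace ℝ (Fin n)))) v ^ p =
        (n + p) * ∫ x in (K : Set (EuclideanSpace ℝ (Fin n))), max 0 (inner ℝ v x) ^ p) ∧
    anisoEnergy p (polarMomentBody p (K : Set (EuclideanSpace ℝ (Fin n)))) g < ⊤ ∧
    Tendsto
      (fun s : ℝ => ENNReal.ofReal (1 - s) *
        asymFracEnergy p s (K : Set (EuclideanSpace ℝ (Fin n))) f)
      (𝓝[<] 1)
      (𝓝 (ENNReal.ofReal (1 / p) *
        anisoEnergy p (polarMomentBody p (K : Set (EuclideanSpace ℝ (Fin n)))) g)) := by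
  have h0 : 0 < p := zero_lt_one.trans_le hp
  refine ⟨fun v => gauge_polarMomentBody_rpow h0 v, ?_⟩
  -- Polar coordinates need a nontrivial space; in dimension zero both energies vanish.
  rcases subsingleton_or_nontrivial (EuclideanSpace ℝ (Fin n)) with hE | hE
  · have h1 : anisoEnergy p (polarMomentBody p (K : Set (EuclideanSpace ℝ (Fin n)))) g = 0 := by
      simp [anisoEnergy, Subsingleton.elim (g _) 0, Real.zero_rpow h0.ne']
    have h2 : ∀ s, asymFracEnergy p s (K : Set (EuclideanSpace ℝ (Fin n))) f = 0 := fun s => by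
      have : ∀ x y, f x - f y = 0 := fun x y => by rw [Subsingleton.elim x y, sub_self]
      simp [asymFracEnergy, this, Real.zero_rpow h0.ne']
    simp [h1, h2]
  · obtain ⟨hfp, g₀, hg₀, hgp₀⟩ := hf
    have hgp : MemLp g (ENNReal.ofReal p) volume := hgp₀.ae_eq (hg₀.ae_eq hg)
    -- Borel representatives make `f (y + z)` and `g (y + t • z)` jointly measurable, as Tonelli
    -- requires; neither energy sees the change on a null set.
    obtain ⟨f', hfm, hff⟩ := hfp.1.aemeasurable
    obtain ⟨g', hgm, hgg⟩ := hgp.1.aemeasurable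
    have hw : HasWeakGradient f' g' := hg.congr_ae hff hgg
    have hfp' := hfp.ae_eq hff
    have hgp' := hgp.ae_eq hgg
    have hinc := fun z => ae_sub_eq_integral_inner hw.locallyIntegrable hfm
      hw.locallyIntegrable_grad hgm (fun φ hφ hc z => hw.integral_fderiv_apply hφ hc z) z
    have hlt := lintegral_ofReal_moment_lt_top hK hp hgm hgp'
    have hlim := tendsto_fracEnergy hK hp hfm hfp' hgm hw.locallyIntegrable_grad hgp' hinc
    rw [finrank_euclideanSpace_fin] at hlt hlim
    simp_rw [asymFracEnergy_congr_ae hff, anisoEnergy_congr_ae hgg, anisoEnergy_polarMomentBody h0]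
    exact ⟨hlt, hlim⟩
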